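/- Let $s$ processes $x_\ell(k+1)=A_\ell x_\ell(k)+B_\ell u_\ell(k)$, $x_\ell(k)\in\mathbb R^{n_\ell}$, $u_\ell(k)\in\mathbb R^{m_\ell}$, $\ell\in\mathbb L=\{1,\dots,s\}$, be given, with each $(A_\ell,B_\ell)$ controllable, symmetric weights $Q_\ell>0$, $R_\ell>0$, and $\alpha_\ell\ge 0$. Let $\mathcal I^0\subset\{1,2,\dots\}$ be finite with $\mathbb L\subseteq\mathcal I^0$, put $\gamma=\max\mathcal I^0$, let $$p=\max\{i\in\mathcal I^0:\ \lambda^i\ne 1\text{ for every }\ell\text{ and every complex eigenvalue }\lambda\neq 1\text{ of }A_\ell\},$$ and assume $s\le p$. *Gains and costs.* For a loop (index $\ell$ dropped) put $A^{(i)}=A^i$, $B^{(i)}=\sum_{q=0}^{i-1}A^qB$, $Q^{(1)}=Q$, $R^{(1)}=R$, $N^{(1)}=0$ and $$Q^{(i)}=Q^{(i-1)}+{A^{(i-1)}}^TQA^{(i-1)},\quad R^{(i)}=R^{(i-1)}+{B^{(i-1)}}^TQB^{(i-1)}+R,\quad N^{(i)}=N^{(i-1)}+{A^{(i-1)}}^TQB^{(i-1)}.$$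 Assume that the down-sampled pair $(A_\ell^{(p)},B_\ell^{(p)})$ is controllable for every $\ell$. For $i\geq 1$ put $$L^{(i)}=\big(R^{(i)}+{B^{(i)}}^TP^{(p)}B^{(i)}\big)^{-1}\big({A^{(i)}}^TP^{(p)}B^{(i)}+N^{(i)}\big)^T,$$ $$P^{(i)}=Q^{(i)}+{A^{(i)}}^TP^{(p)}A^{(i)}-\big({A^{(i)}}^TP^{(p)}B^{(i)}+N^{(i)}\big)L^{(i)},$$ where $P^{(p)}$ is the positive semidefinite solution of the second equation with $i=p$ (a Riccati equation). *Algorithm (conflict-free multi-loop self-triggered MPC).* At each time $k$ at which sensor $\ell$ transmits the sample $x_\ell(k)$, the controller forms $$\mathcal I_\ell(k)=\{i\in\mathcal I^0:\ i\neq k_q^{\mathrm{next}}-k+rp\ \text{ for all } r\in\mathbb Z,\ q\in\mathbb L\setminus\{\ell\}\},$$ where $k_q^{\mathrm{next}}$ is the scheduled next transmission time of sensor $q$. It picks a minimizer $I$ of $\alpha_\ell/i+x_\ell(k)^TP_\ell^{(i)}x_\ell(k)$ over $i\in\mathcal I_\ell(k)$, applies the constant input $-L_\ell^{(I)}x_\ell(k)$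 at the times $k,\dots,k+I-1$, and schedules the next transmission of sensor $\ell$ at time $k+I$. At time $0$ all states are known and this is done for $\ell=1,\dots,s$ in this order, the condition defining $\mathcal I_\ell(0)$ involving only the loops $q<\ell$, which are already scheduled. *Claim.* Suppose that either (a) for every $\ell$, no eigenvalue of $A_\ell$, except possibly $1$, has modulus $1$ and complex argument $\frac{2\pi}{\gamma}j$ (modulo $2\pi$) for some integer $j\ge 1$; or (b) $\alpha_\ell=0$ for every $\ell$. Then from every collection of initial states the algorithm can be executed for all times, and in every execution $\lim_{k\to\infty}x_\ell(k)=0$ for every $\ell$. -/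

import Mathlib

open Filter Topology Matrix

noncomputable section

namespace SelfTriggeredMPC

/-- The data of one control loop: the process `x(k+1) = A x(k) + B u(k)`, the weights `Q`, `R`
of the quadratic cost, and the weight `α` of the sampling cost `α / i`. -/
structure ControlLoop (n m : ℕ) where
  A : Matrix (Fin n) (Fin n) ℝ
  B : Matrix (Fin n) (Fin m) ℝ
  Q : Matrix (Fin n) (Fin n) ℝ
  R : Matrix (Fin m) (Fin m) ℝ
  α : ℝ

/-- The quadratic form `‖x‖²_M = xᵀ M x`. -/
def quadForm {n : ℕ} (M : Matrix (Fin n) (Fin n) ℝ) (x : Fin n → ℝ) : ℝ :=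
  x ⬝ᵥ (M *ᵥ x)

/-- The controllability matrix `[B, A B, …, A^(n-1) B]`; its columns are indexed by the pairs
(power of `A`, column of `B`). -/
def controllabilityMatrix {n m : ℕ} (A : Matrix (Fin n) (Fin n) ℝ)
    (B : Matrix (Fin n) (Fin m) ℝ) : Matrix (Fin n) (Fin n × Fin m) ℝ :=
  Matrix.of fun a c => (A ^ (c.1 : ℕ) * B) a c.2

/-- Controllability of the pair `(A, B)` (Kalman rank condition). -/
def IsControllable {n m : ℕ} (A : Matrix (Fin n) (Fin n) ℝ) (B : Matrix (Fin n) (Fin m) ℝ) :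
    Prop :=
  (controllabilityMatrix A B).rank = n

/-- The set `λ(A)` of complex eigenvalues of a real square matrix. -/
def eigenvalues {n : ℕ} (A : Matrix (Fin n) (Fin n) ℝ) : Set ℂ :=
  spectrum ℂ (A.map (algebraMap ℝ ℂ))

/-- No eigenvalue of `A`, except possibly `1`, has modulus one and complex argument
`(2π / γ) n` (as an angle, that is modulo `2π`) for some positive integer `n`. -/
def EigenvalueArgumentCondition {n : ℕ} (A : Matrix (Fin n) (Fin n) ℝ) (γ : ℕ) : Prop :=
  ¬ ∃ z ∈ eigenvalues A, z ≠ 1 ∧ ‖z‖ = 1 ∧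
    ∃ j : ℕ, 0 < j ∧ (Complex.arg z : Real.Angle) = ((2 * Real.pi / γ * j : ℝ) : Real.Angle)

namespace ControlLoop

variable {n m : ℕ} (c : ControlLoop n m)

/-- `A^(i) = A^i`. -/
def liftA (i : ℕ) : Matrix (Fin n) (Fin n) ℝ := c.A ^ i

/-- `B^(i) = ∑_{q < i} A^q B`. -/
def liftB (i : ℕ) : Matrix (Fin n) (Fin m) ℝ := ∑ q ∈ Finset.range i, c.A ^ q * c.B

/-- `Q^(i) = Q^(i-1) + (A^(i-1))ᵀ Q A^(i-1)`. Starting the recursion with `0` at `i = 0` is the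
same as starting it with `Q^(1) = Q`. -/
def liftQ : ℕ → Matrix (Fin n) (Fin n) ℝ
  | 0 => 0
  | i + 1 => liftQ i + (c.liftA i)ᵀ * c.Q * c.liftA i

/-- `R^(i) = R^(i-1) + (B^(i-1))ᵀ Q B^(i-1) + R`, with `R^(1) = R`. -/
def liftR : ℕ → Matrix (Fin m) (Fin m) ℝ
  | 0 => 0
  | i + 1 => liftR i + (c.liftB i)ᵀ * c.Q * c.liftB i + c.R

/-- `N^(i) = N^(i-1) + (A^(i-1))ᵀ Q B^(i-1)`, with `N^(1) = 0`. -/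
def liftN : ℕ → Matrix (Fin n) (Fin m) ℝ
  | 0 => 0
  | i + 1 => liftN i + (c.liftA i)ᵀ * c.Q * c.liftB i

theorem liftQ_one : c.liftQ 1 = c.Q := by simp [liftQ, liftA]

theorem liftR_one : c.liftR 1 = c.R := by simp [liftR, liftB]

theorem liftN_one : c.liftN 1 = 0 := by simp [liftN, liftB]

/-- The `i`-step feedback gain belonging to the terminal weight `P`:
`(R^(i) + (B^(i))ᵀ P B^(i))⁻¹ ((A^(i))ᵀ P B^(i) + N^(i))ᵀ`. -/
def riccatiGain (P : Matrix (Fin n) (Fin n) ℝ) (i : ℕ) : Matrix (Fin m) (Fin n) ℝ :=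
  (c.liftR i + (c.liftB i)ᵀ * P * c.liftB i)⁻¹ * ((c.liftA i)ᵀ * P * c.liftB i + c.liftN i)ᵀ

/-- The `i`-step Riccati operator applied to the terminal weight `P`. -/
def riccatiStep (P : Matrix (Fin n) (Fin n) ℝ) (i : ℕ) : Matrix (Fin n) (Fin n) ℝ :=
  c.liftQ i + (c.liftA i)ᵀ * P * c.liftA i
    - ((c.liftA i)ᵀ * P * c.liftB i + c.liftN i) * c.riccatiGain P i

/-- `P` is a positive semidefinite solution of the algebraic Riccati equation of period `p`. -/
def IsRiccatiSolution (p : ℕ) (P : Matrix (Fin n) (Fin n) ℝ) : Prop :=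
  P.PosSemidef ∧ P = c.riccatiStep P p

/-- `P^(p)`, the positive semidefinite solution of the algebraic Riccati equation of period `p`
(it is unique when `Q` and `R` are positive definite; the value is junk if there is none). -/
def riccatiP (p : ℕ) : Matrix (Fin n) (Fin n) ℝ :=
  Classical.epsilon (c.IsRiccatiSolution p)

/-- `P^(i)`, computed from the terminal weight `P^(p)`. -/
def costP (p i : ℕ) : Matrix (Fin n) (Fin n) ℝ := c.riccatiStep (c.riccatiP p) i

/-- `L^(i)`, computed from the terminal weight `P^(p)`. -/
def gainL (p i : ℕ) : Matrix (Fin m) (Fin n) ℝ := c.riccatiGain (c.riccatiP p) i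

/-- The cost `α / i + ‖x‖²_{P^(i)}` of waiting `i` time steps until the next sample. -/
def waitCost (p : ℕ) (x : Fin n → ℝ) (i : ℕ) : ℝ := c.α / i + quadForm (c.costP p i) x

end ControlLoop

/-- The waiting times that a loop may choose at time `k` when the loops `q` with `others q`
have their next transmission at time `next q`:
`{i ∈ I0 | i ≠ next q - k + r p for all r ∈ ℤ and all such q}`. -/
def feasible {s : ℕ} (I0 : Finset ℕ) (p : ℕ) (others : Fin s → Prop) (next : Fin s → ℕ)
    (k : ℕ) : Set ℕ :=
  {i | i ∈ I0 ∧ ∀ q, others q → ∀ r : ℤ, (i : ℤ) ≠ (next q : ℤ) - (k : ℤ) + r * (p : ℤ)}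

/-- The controller's step for one loop at time `k`, with sample `x`: it selects a waiting time
`i` in `F` of least cost (any minimizer), applies the control value `v = -L^(i) x`, and has the
next sample scheduled at time `t = k + i`. -/
def ControlStep {n m : ℕ} (c : ControlLoop n m) (p : ℕ) (F : Set ℕ) (k : ℕ) (x : Fin n → ℝ)
    (v : Fin m → ℝ) (t : ℕ) : Prop :=
  ∃ i ∈ F, (∀ j ∈ F, c.waitCost p x i ≤ c.waitCost p x j) ∧
    v = -(c.gainL p i *ᵥ x) ∧ t = k + i

/-- An execution of the multiple loop self-triggered MPC. Here `x ℓ k` and `u ℓ k` are state and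
input of process `ℓ` at time `k`, and `next ℓ k` is the time of the next transmission of sensor
`ℓ` that is scheduled once everything at time `k` has been done. Loops are indexed from `0`. -/
structure IsExecution {s : ℕ} {n m : Fin s → ℕ} (c : ∀ ℓ, ControlLoop (n ℓ) (m ℓ))
    (I0 : Finset ℕ) (p : ℕ) (x : ∀ ℓ, ℕ → Fin (n ℓ) → ℝ) (u : ∀ ℓ, ℕ → Fin (m ℓ) → ℝ)
    (next : Fin s → ℕ → ℕ) : Prop where
  /-- The processes. -/
  dynamics : ∀ ℓ k, x ℓ (k + 1) = (c ℓ).A *ᵥ x ℓ k + (c ℓ).B *ᵥ u ℓ k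
  /-- At time `0` all states are known and the loops are treated in increasing order; only the
  loops before `ℓ` already have a next transmission time. -/
  init : ∀ ℓ, ControlStep (c ℓ) p (feasible I0 p (fun q => q < ℓ) (fun q => next q 0) 0) 0
    (x ℓ 0) (u ℓ 0) (next ℓ 0)
  /-- When sensor `ℓ` transmits, the controller's step is performed for loop `ℓ`. -/
  sample : ∀ ℓ k, next ℓ k = k + 1 →
    ControlStep (c ℓ) p (feasible I0 p (fun q => q ≠ ℓ) (fun q => next q k) (k + 1)) (k + 1)
      (x ℓ (k + 1)) (u ℓ (k + 1)) (next ℓ (k + 1))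
  /-- Otherwise the actuator holds its value and the schedule of sensor `ℓ` is kept. -/
  hold : ∀ ℓ k, next ℓ k ≠ k + 1 → u ℓ (k + 1) = u ℓ k ∧ next ℓ (k + 1) = next ℓ k

end SelfTriggeredMPC

end

open SelfTriggeredMPC

/-! Each loop has a Lyapunov function: the stage cost from now until its next transmission plus the
terminal cost `xᵀ P^(p) x` there (`remainingCost`). While the input is held, this loses exactly the
current stage cost. At a sample the planned cost becomes `xᵀ P^(I) x`, because `riccatiStep` is the
minimum of the hold cost over constant inputs and `gainL` attains it. If `p` is admissible,
minimality gives `α/I + xᵀ P^(I) x ≤ α/p + xᵀ P^(p) x`, and `α/p ≤ α/I` then shows that re-planning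
does not raise the cost (`remainingCost_succ_le`). Hence the stage costs are summable, and `Q > 0`
forces `x → 0`.

Three facts remain. The waiting time `p` is always admissible after time `0`, because scheduled
times stay pairwise incongruent modulo `p` and waiting `p` keeps the residue. The inequality `α/p ≤
α/I` is trivial if `α = 0`; under (a) no eigenvalue other than `1` is a `γ`-th root of unity, so `p
= γ ≥ I`. The Riccati equation is solvable: value iteration from `0` increases and is bounded by the
cost of steering to the origin. -/

noncomputable section

namespace SelfTriggeredMPC

/-! ### Quadratic forms -/

section QuadForm

variable {n m : ℕ}

theorem quadForm_add (M N : Matrix (Fin n) (Fin n) ℝ) (x : Fin n → ℝ) :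
    quadForm (M + N) x = quadForm M x + quadForm N x := by
  simp [quadForm, add_mulVec, dotProduct_add]

theorem quadForm_sub (M N : Matrix (Fin n) (Fin n) ℝ) (x : Fin n → ℝ) :
    quadForm (M - N) x = quadForm M x - quadForm N x := by
  simp [quadForm, sub_mulVec, dotProduct_sub]

theorem quadForm_vec_zero (M : Matrix (Fin n) (Fin n) ℝ) : quadForm M 0 = 0 := by
  simp [quadForm]

theorem quadForm_mat_zero (x : Fin n → ℝ) : quadForm 0 x = 0 := by
  simp [quadForm]

theorem quadForm_nonneg {M : Matrix (Fin n) (Fin n) ℝ} (hM : M.PosSemidef) (x : Fin n → ℝ) :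
    0 ≤ quadForm M x := by
  simpa [quadForm] using hM.dotProduct_mulVec_nonneg x

theorem posSemidef_of_quadForm_nonneg {M : Matrix (Fin n) (Fin n) ℝ} (hM : Mᵀ = M)
    (h : ∀ x, 0 ≤ quadForm M x) : M.PosSemidef :=
  .of_dotProduct_mulVec_nonneg (by simpa [IsHermitian] using hM) (by simpa [quadForm] using h)

theorem transpose_eq_of_posSemidef {M : Matrix (Fin n) (Fin n) ℝ} (hM : M.PosSemidef) :
    Mᵀ = M := by
  simpa [IsHermitian] using hM.1

theorem posSemidef_transpose_mul_mul {M : Matrix (Fin n) (Fin n) ℝ} (hM : M.PosSemidef)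
    (T : Matrix (Fin n) (Fin m) ℝ) : (Tᵀ * M * T).PosSemidef := by
  simpa using hM.conjTranspose_mul_mul_same T

/-- Expansion of a quadratic form at a sum of two linear images. -/
theorem quadForm_mulVec_add_mulVec {l : ℕ} {M : Matrix (Fin l) (Fin l) ℝ} (hM : Mᵀ = M)
    (S : Matrix (Fin l) (Fin n) ℝ) (T : Matrix (Fin l) (Fin m) ℝ) (x : Fin n → ℝ)
    (v : Fin m → ℝ) :
    quadForm M (S *ᵥ x + T *ᵥ v) =
      quadForm (Sᵀ * M * S) x + 2 * (x ⬝ᵥ ((Sᵀ * M * T) *ᵥ v)) + quadForm (Tᵀ * M * T) v := by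
  have h : (T *ᵥ v) ⬝ᵥ (M *ᵥ (S *ᵥ x)) = (S *ᵥ x) ⬝ᵥ (M *ᵥ (T *ᵥ v)) := by
    have h' : (T *ᵥ v) ᵥ* M = M *ᵥ (T *ᵥ v) := by
      rw [← vecMul_transpose M, hM]
    rw [dotProduct_mulVec, h', dotProduct_comm]
  simp only [quadForm, mulVec_add, add_dotProduct, dotProduct_add, h, ← mulVec_mulVec]
  simp only [dotProduct_mulVec, vecMul_transpose]
  ring

/-- Completion of the square. -/
theorem quadForm_add_cross_add_quadForm (H : Matrix (Fin n) (Fin n) ℝ)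
    (S : Matrix (Fin n) (Fin m) ℝ) {G : Matrix (Fin m) (Fin m) ℝ} (hG : G.PosDef)
    (x : Fin n → ℝ) (v : Fin m → ℝ) :
    quadForm H x + 2 * (x ⬝ᵥ (S *ᵥ v)) + quadForm G v =
      quadForm (H - S * (G⁻¹ * Sᵀ)) x + quadForm G (v + (G⁻¹ * Sᵀ) *ᵥ x) := by
  have hGt : Gᵀ = G := transpose_eq_of_posSemidef hG.posSemidef
  have hu : IsUnit G.det := (Matrix.isUnit_iff_isUnit_det _).1 hG.isUnit
  have e := quadForm_mulVec_add_mulVec hGt (G⁻¹ * Sᵀ) (1 : Matrix (Fin m) (Fin m) ℝ) x v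
  have h1 : (G⁻¹ * Sᵀ)ᵀ * G = S := by
    rw [transpose_mul, transpose_transpose, transpose_nonsing_inv, hGt, Matrix.mul_assoc,
      nonsing_inv_mul _ hu, Matrix.mul_one]
  simp only [h1, one_mulVec, Matrix.mul_one, transpose_one, Matrix.one_mul] at e
  rw [add_comm v, e, quadForm_sub]
  ring

open scoped MatrixOrder Matrix.Norms.L2Operator in
theorem exists_isUnit_transpose_mul_self {M : Matrix (Fin n) (Fin n) ℝ} (hM : M.PosDef) :
    ∃ y : Matrix (Fin n) (Fin n) ℝ, IsUnit y ∧ M = yᵀ * y := by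
  obtain ⟨y, hy, h⟩ := CStarAlgebra.isStrictlyPositive_iff_eq_star_mul_self.mp
    hM.isStrictlyPositive
  exact ⟨y, hy, by simpa [star_eq_conjTranspose] using h⟩

/-- With `M = yᵀ y` and `y` invertible, the form is the sum of squares of the entries of `y x`; each
entry tends to zero, and `y⁻¹` carries this back to `x`. -/
theorem tendsto_zero_of_quadForm {M : Matrix (Fin n) (Fin n) ℝ} (hM : M.PosDef)
    {x : ℕ → Fin n → ℝ} (h : Tendsto (fun k => quadForm M (x k)) atTop (𝓝 0)) :
    Tendsto x atTop (𝓝 0) := by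
  obtain ⟨y, hy, rfl⟩ := exists_isUnit_transpose_mul_self hM
  have hq : ∀ k, quadForm (yᵀ * y) (x k) = ∑ i, (y *ᵥ x k) i ^ 2 := by
    intro k
    simp only [quadForm, ← mulVec_mulVec]
    rw [dotProduct_mulVec, vecMul_transpose]
    simp [dotProduct, sq]
  have hyx : Tendsto (fun k => y *ᵥ x k) atTop (𝓝 0) := by
    refine tendsto_pi_nhds.2 fun i => ?_
    have h2 : Tendsto (fun k => (y *ᵥ x k) i ^ 2) atTop (𝓝 0) := by
      refine squeeze_zero (fun k => sq_nonneg _) (fun k => ?_) h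
      rw [hq]
      exact Finset.single_le_sum (f := fun i => (y *ᵥ x k) i ^ 2) (fun _ _ => sq_nonneg _)
        (Finset.mem_univ i)
    have h3 := h2.sqrt
    simp only [Real.sqrt_sq_eq_abs, Real.sqrt_zero] at h3
    exact (tendsto_zero_iff_abs_tendsto_zero _).2 h3
  have hc : Continuous fun w : Fin n → ℝ => y⁻¹ *ᵥ w := by fun_prop
  have h4 := (hc.tendsto 0).comp hyx
  have hu : IsUnit y.det := (Matrix.isUnit_iff_isUnit_det _).1 hy
  simpa [Function.comp_def, mulVec_mulVec, nonsing_inv_mul _ hu] using h4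

/-- Polarization: the entries of a symmetric matrix are determined by its quadratic form. -/
theorem apply_eq_quadForm {M : Matrix (Fin n) (Fin n) ℝ} (hM : Mᵀ = M) (i j : Fin n) :
    M i j = (quadForm M (Pi.single i 1 + Pi.single j 1) - quadForm M (Pi.single i 1)
      - quadForm M (Pi.single j 1)) / 2 := by
  have h : M j i = M i j := congrFun (congrFun hM i) j
  simp [quadForm, mulVec_add, h]
  ring

end QuadForm

/-! ### Hold costs and the Riccati operator -/

namespace ControlLoop

variable {n m : ℕ} (c : ControlLoop n m)

/-- The cost of one time step with state `x` and input `v`. -/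
def stageCost (x : Fin n → ℝ) (v : Fin m → ℝ) : ℝ := quadForm c.Q x + quadForm c.R v

/-- The state after `i` steps with constant input `v`, starting from `x`. -/
def liftState (i : ℕ) (x : Fin n → ℝ) (v : Fin m → ℝ) : Fin n → ℝ :=
  c.liftA i *ᵥ x + c.liftB i *ᵥ v

/-- The cost of `i` steps with constant input `v` and terminal weight `P`. -/
def holdCost (P : Matrix (Fin n) (Fin n) ℝ) (i : ℕ) (x : Fin n → ℝ) (v : Fin m → ℝ) : ℝ :=
  ∑ q ∈ Finset.range i, c.stageCost (c.liftState q x v) v + quadForm P (c.liftState i x v)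

theorem liftState_zero (x : Fin n → ℝ) (v : Fin m → ℝ) : c.liftState 0 x v = x := by
  simp [liftState, liftA, liftB]

theorem liftState_succ (i : ℕ) (x : Fin n → ℝ) (v : Fin m → ℝ) :
    c.liftState (i + 1) x v = c.A *ᵥ c.liftState i x v + c.B *ᵥ v := by
  have h : c.liftB (i + 1) = c.A * c.liftB i + c.B := by
    simp only [liftB]
    rw [Finset.sum_range_succ', Matrix.mul_sum]
    simp [pow_succ', Matrix.mul_assoc]
  simp [liftState, liftA, h, pow_succ', mulVec_add, add_mulVec, mulVec_mulVec, add_assoc]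

variable {c}

theorem stageCost_nonneg (hQ : c.Q.PosDef) (hR : c.R.PosDef) (x : Fin n → ℝ) (v : Fin m → ℝ) :
    0 ≤ c.stageCost x v :=
  add_nonneg (quadForm_nonneg hQ.posSemidef x) (quadForm_nonneg hR.posSemidef v)

theorem holdCost_nonneg (hQ : c.Q.PosDef) (hR : c.R.PosDef) {P : Matrix (Fin n) (Fin n) ℝ}
    (hP : P.PosSemidef) (i : ℕ) (x : Fin n → ℝ) (v : Fin m → ℝ) : 0 ≤ c.holdCost P i x v :=
  add_nonneg (Finset.sum_nonneg fun _ _ => stageCost_nonneg hQ hR _ _) (quadForm_nonneg hP _)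

theorem sum_stageCost_eq (hQ : c.Q.PosDef) (i : ℕ) (x : Fin n → ℝ) (v : Fin m → ℝ) :
    ∑ q ∈ Finset.range i, c.stageCost (c.liftState q x v) v =
      quadForm (c.liftQ i) x + 2 * (x ⬝ᵥ (c.liftN i *ᵥ v)) + quadForm (c.liftR i) v := by
  induction i with
  | zero => simp [liftQ, liftN, liftR, quadForm_mat_zero]
  | succ i ih =>
    rw [Finset.sum_range_succ, ih, stageCost, liftState,
      quadForm_mulVec_add_mulVec (transpose_eq_of_posSemidef hQ.posSemidef)]
    simp only [liftQ, liftN, liftR, quadForm_add, add_mulVec, dotProduct_add]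
    ring

theorem holdCost_eq (hQ : c.Q.PosDef) {P : Matrix (Fin n) (Fin n) ℝ} (hP : P.PosSemidef) (i : ℕ)
    (x : Fin n → ℝ) (v : Fin m → ℝ) :
    c.holdCost P i x v =
      quadForm (c.liftQ i + (c.liftA i)ᵀ * P * c.liftA i) x
        + 2 * (x ⬝ᵥ (((c.liftA i)ᵀ * P * c.liftB i + c.liftN i) *ᵥ v))
        + quadForm (c.liftR i + (c.liftB i)ᵀ * P * c.liftB i) v := by
  rw [holdCost, sum_stageCost_eq hQ, liftState,
    quadForm_mulVec_add_mulVec (transpose_eq_of_posSemidef hP)]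
  simp only [quadForm_add, add_mulVec, dotProduct_add]
  ring

theorem posSemidef_liftQ (hQ : c.Q.PosDef) (i : ℕ) : (c.liftQ i).PosSemidef := by
  induction i with
  | zero => exact .zero
  | succ i ih => exact ih.add (posSemidef_transpose_mul_mul hQ.posSemidef _)

theorem posSemidef_liftR (hQ : c.Q.PosDef) (hR : c.R.PosDef) (i : ℕ) :
    (c.liftR i).PosSemidef := by
  induction i with
  | zero => exact .zero
  | succ i ih =>
    exact (ih.add (posSemidef_transpose_mul_mul hQ.posSemidef _)).add hR.posSemidef

theorem posDef_liftR (hQ : c.Q.PosDef) (hR : c.R.PosDef) {i : ℕ} (hi : 0 < i) :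
    (c.liftR i).PosDef := by
  obtain ⟨i, rfl⟩ := Nat.exists_eq_succ_of_ne_zero hi.ne'
  exact .posSemidef_add
    ((posSemidef_liftR hQ hR i).add (posSemidef_transpose_mul_mul hQ.posSemidef _)) hR

theorem posDef_liftR_add (hQ : c.Q.PosDef) (hR : c.R.PosDef) {i : ℕ} (hi : 0 < i)
    {P : Matrix (Fin n) (Fin n) ℝ} (hP : P.PosSemidef) :
    (c.liftR i + (c.liftB i)ᵀ * P * c.liftB i).PosDef :=
  (posDef_liftR hQ hR hi).add_posSemidef (posSemidef_transpose_mul_mul hP _)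

/-- Completing the square in `v` exhibits `riccatiStep` as the minimum over constant inputs,
attained at minus the gain. Positivity of `i` makes the quadratic part in `v` definite, as `liftR 0
= 0`. -/
theorem holdCost_eq_riccatiStep (hQ : c.Q.PosDef) (hR : c.R.PosDef) {i : ℕ} (hi : 0 < i)
    {P : Matrix (Fin n) (Fin n) ℝ} (hP : P.PosSemidef) (x : Fin n → ℝ) (v : Fin m → ℝ) :
    c.holdCost P i x v = quadForm (c.riccatiStep P i) x +
      quadForm (c.liftR i + (c.liftB i)ᵀ * P * c.liftB i) (v + c.riccatiGain P i *ᵥ x) := by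
  rw [holdCost_eq hQ hP, quadForm_add_cross_add_quadForm _ _ (posDef_liftR_add hQ hR hi hP)]
  rfl

theorem riccatiStep_le_holdCost (hQ : c.Q.PosDef) (hR : c.R.PosDef) {i : ℕ} (hi : 0 < i)
    {P : Matrix (Fin n) (Fin n) ℝ} (hP : P.PosSemidef) (x : Fin n → ℝ) (v : Fin m → ℝ) :
    quadForm (c.riccatiStep P i) x ≤ c.holdCost P i x v := by
  rw [holdCost_eq_riccatiStep hQ hR hi hP]
  exact le_add_of_nonneg_right (quadForm_nonneg (posDef_liftR_add hQ hR hi hP).posSemidef _)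

theorem holdCost_riccatiGain (hQ : c.Q.PosDef) (hR : c.R.PosDef) {i : ℕ} (hi : 0 < i)
    {P : Matrix (Fin n) (Fin n) ℝ} (hP : P.PosSemidef) (x : Fin n → ℝ) :
    c.holdCost P i x (-(c.riccatiGain P i *ᵥ x)) = quadForm (c.riccatiStep P i) x := by
  rw [holdCost_eq_riccatiStep hQ hR hi hP, neg_add_cancel, quadForm_vec_zero, add_zero]

theorem posSemidef_riccatiStep (hQ : c.Q.PosDef) (hR : c.R.PosDef) {i : ℕ} (hi : 0 < i)
    {P : Matrix (Fin n) (Fin n) ℝ} (hP : P.PosSemidef) : (c.riccatiStep P i).PosSemidef := by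
  refine posSemidef_of_quadForm_nonneg ?_ fun x => ?_
  · have h1 := transpose_eq_of_posSemidef (posSemidef_liftQ hQ i)
    have h2 := transpose_eq_of_posSemidef (posSemidef_transpose_mul_mul hP (c.liftA i))
    have h3 := transpose_eq_of_posSemidef (posDef_liftR_add hQ hR hi hP).posSemidef
    rw [riccatiStep, riccatiGain, transpose_sub, transpose_add, h1, h2, transpose_mul,
      transpose_mul, transpose_transpose, transpose_nonsing_inv, h3,
      Matrix.mul_assoc ((c.liftA i)ᵀ * P * c.liftB i + c.liftN i)]
  · rw [← holdCost_riccatiGain hQ hR hi hP]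
    exact holdCost_nonneg hQ hR hP _ _ _

/-- The input optimal for `P'` is a competitor in the minimization for `P`. -/
theorem riccatiStep_mono (hQ : c.Q.PosDef) (hR : c.R.PosDef) {i : ℕ} (hi : 0 < i)
    {P P' : Matrix (Fin n) (Fin n) ℝ} (hP : P.PosSemidef) (hP' : P'.PosSemidef)
    (h : ∀ x, quadForm P x ≤ quadForm P' x) (x : Fin n → ℝ) :
    quadForm (c.riccatiStep P i) x ≤ quadForm (c.riccatiStep P' i) x := by
  rw [← holdCost_riccatiGain hQ hR hi hP']
  refine (riccatiStep_le_holdCost hQ hR hi hP x (-(c.riccatiGain P' i *ᵥ x))).trans ?_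
  exact add_le_add_right (h _) _

/-! ### Value iteration and steering -/

theorem tendsto_riccatiStep (hQ : c.Q.PosDef) (hR : c.R.PosDef) {i : ℕ} (hi : 0 < i)
    {P : Matrix (Fin n) (Fin n) ℝ} (hP : P.PosSemidef) :
    Tendsto (fun P => c.riccatiStep P i) (𝓝 P) (𝓝 (c.riccatiStep P i)) := by
  have hdet : (c.liftR i + (c.liftB i)ᵀ * P * c.liftB i).det ≠ 0 :=
    (posDef_liftR_add hQ hR hi hP).det_pos.ne'
  have hinv : Tendsto (fun P : Matrix (Fin n) (Fin n) ℝ => (c.liftR i + (c.liftB i)ᵀ * P * c.liftB i)⁻¹)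
      (𝓝 P) (𝓝 (c.liftR i + (c.liftB i)ᵀ * P * c.liftB i)⁻¹) := by
    have h1 : ContinuousAt Inv.inv (c.liftR i + (c.liftB i)ᵀ * P * c.liftB i) := by
      refine continuousAt_matrix_inv _ ?_
      simpa [Ring.inverse_eq_inv'] using continuousAt_inv₀ hdet
    have h2 : Continuous fun P : Matrix (Fin n) (Fin n) ℝ =>
        c.liftR i + (c.liftB i)ᵀ * P * c.liftB i := by fun_prop
    exact h1.tendsto.comp (h2.tendsto P)
  have hc : Continuous fun y : Matrix (Fin n) (Fin n) ℝ × Matrix (Fin m) (Fin m) ℝ =>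
      c.liftQ i + (c.liftA i)ᵀ * y.1 * c.liftA i
        - ((c.liftA i)ᵀ * y.1 * c.liftB i + c.liftN i) *
          (y.2 * ((c.liftA i)ᵀ * y.1 * c.liftB i + c.liftN i)ᵀ) := by fun_prop
  have h3 := (hc.tendsto (P, (c.liftR i + (c.liftB i)ᵀ * P * c.liftB i)⁻¹)).comp
    (tendsto_id.prodMk_nhds hinv)
  simp only [riccatiStep, riccatiGain]
  simpa only [Function.comp_def, id] using h3

/-- The `k`-th value iterate of the Riccati operator of period `p`, started at `0`. -/
def valueIter (c : ControlLoop n m) (p k : ℕ) : Matrix (Fin n) (Fin n) ℝ :=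
  (fun P => c.riccatiStep P p)^[k] 0

theorem valueIter_succ (p k : ℕ) :
    c.valueIter p (k + 1) = c.riccatiStep (c.valueIter p k) p :=
  Function.iterate_succ_apply' _ _ _

theorem posSemidef_valueIter (hQ : c.Q.PosDef) (hR : c.R.PosDef) {p : ℕ} (hp : 0 < p) (k : ℕ) :
    (c.valueIter p k).PosSemidef := by
  induction k with
  | zero => exact .zero
  | succ k ih =>
    rw [valueIter_succ]
    exact posSemidef_riccatiStep hQ hR hp ih

theorem monotone_quadForm_valueIter (hQ : c.Q.PosDef) (hR : c.R.PosDef) {p : ℕ} (hp : 0 < p)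
    (x : Fin n → ℝ) : Monotone fun k => quadForm (c.valueIter p k) x := by
  refine monotone_nat_of_le_succ fun k => ?_
  induction k generalizing x with
  | zero =>
    exact (quadForm_mat_zero x).trans_le (quadForm_nonneg (posSemidef_valueIter hQ hR hp 1) x)
  | succ k ih =>
    rw [valueIter_succ, valueIter_succ p (k + 1)]
    exact riccatiStep_mono hQ hR hp (posSemidef_valueIter hQ hR hp k)
      (posSemidef_valueIter hQ hR hp (k + 1)) ih x

theorem holdCost_eq_add (P : Matrix (Fin n) (Fin n) ℝ) (i : ℕ) (x : Fin n → ℝ)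
    (v : Fin m → ℝ) :
    c.holdCost P i x v = c.holdCost 0 i x v + quadForm P (c.liftState i x v) := by
  simp [holdCost, quadForm_mat_zero]

/-- The value iterate bounds the cost of any input sequence from below. -/
theorem quadForm_valueIter_le (hQ : c.Q.PosDef) (hR : c.R.PosDef) {p : ℕ} (hp : 0 < p) (k : ℕ)
    (ξ : ℕ → Fin n → ℝ) (v : ℕ → Fin m → ℝ)
    (h : ∀ j, ξ (j + 1) = c.liftState p (ξ j) (v j)) :
    quadForm (c.valueIter p k) (ξ 0) ≤ ∑ j ∈ Finset.range k, c.holdCost 0 p (ξ j) (v j) := by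
  induction k generalizing ξ v with
  | zero => simp [valueIter, quadForm_mat_zero]
  | succ k ih =>
    rw [valueIter_succ, Finset.sum_range_succ', add_comm]
    refine (riccatiStep_le_holdCost hQ hR hp (posSemidef_valueIter hQ hR hp k) _ (v 0)).trans ?_
    rw [holdCost_eq_add, ← h 0]
    exact add_le_add_right (ih (fun j => ξ (j + 1)) (fun j => v (j + 1)) fun j => h (j + 1)) _

end ControlLoop

/-- Variation of constants for a sequence of inputs. -/
theorem eq_pow_mulVec_add_sum {n m : ℕ} {A : Matrix (Fin n) (Fin n) ℝ}
    {B : Matrix (Fin n) (Fin m) ℝ} {ξ : ℕ → Fin n → ℝ} {v : ℕ → Fin m → ℝ}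
    (h : ∀ j, ξ (j + 1) = A *ᵥ ξ j + B *ᵥ v j) (k : ℕ) :
    ξ k = A ^ k *ᵥ ξ 0 + ∑ a ∈ Finset.range k, (A ^ a * B) *ᵥ v (k - 1 - a) := by
  induction k with
  | zero => simp
  | succ k ih =>
    rw [h, ih, Finset.sum_range_succ', mulVec_add, mulVec_mulVec, ← pow_succ', mulVec_sum,
      add_assoc]
    congr 2
    · refine Finset.sum_congr rfl fun a _ => ?_
      rw [mulVec_mulVec, ← Matrix.mul_assoc, ← pow_succ']
      congr 2
      omega
    · simp

/-- A controllable pair can be steered to the origin in `n` steps. -/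
theorem IsControllable.exists_steering {n m : ℕ} {A : Matrix (Fin n) (Fin n) ℝ}
    {B : Matrix (Fin n) (Fin m) ℝ} (h : IsControllable A B) (x : Fin n → ℝ) :
    ∃ (ξ : ℕ → Fin n → ℝ) (v : ℕ → Fin m → ℝ), ξ 0 = x ∧
      (∀ j, ξ (j + 1) = A *ᵥ ξ j + B *ᵥ v j) ∧ ∀ j, n ≤ j → ξ j = 0 ∧ v j = 0 := by
  have hs : LinearMap.range (controllabilityMatrix A B).mulVecLin = ⊤ :=
    Submodule.eq_top_of_finrank_eq (by
      rw [Module.finrank_fin_fun]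
      exact h)
  obtain ⟨w, hw⟩ := LinearMap.range_eq_top.1 hs (-(A ^ n *ᵥ x))
  -- In the variation of constants `A^a B` multiplies the input at time `n - 1 - a`, hence the
  -- reversed index.
  let v : ℕ → Fin m → ℝ := fun j b => if hj : j < n then w (⟨n - 1 - j, by omega⟩, b) else 0
  let ξ : ℕ → Fin n → ℝ := fun j => Nat.rec x (fun j y => A *ᵥ y + B *ᵥ v j) j
  have hξ : ∀ j, ξ (j + 1) = A *ᵥ ξ j + B *ᵥ v j := fun _ => rfl
  have hv : ∀ j, n ≤ j → v j = 0 := fun j hj => by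
    ext b
    simp [v, hj.not_gt]
  have hn : ξ n = 0 := by
    have h0 : ξ 0 = x := rfl
    rw [eq_pow_mulVec_add_sum hξ n, h0, add_comm, add_eq_zero_iff_eq_neg, ← hw]
    ext a
    rw [Finset.sum_range]
    simp only [Matrix.mulVecLin_apply, mulVec, dotProduct, Finset.sum_apply,
      Fintype.sum_prod_type, controllabilityMatrix, Matrix.of_apply]
    refine Finset.sum_congr rfl fun k _ => Finset.sum_congr rfl fun b _ => ?_
    have hk := k.2
    have e : n - 1 - (n - 1 - (k : ℕ)) = k := by omega
    have hlt : n - 1 - (k : ℕ) < n := by omega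
    simp only [v, hlt, dif_pos, e]
  refine ⟨ξ, v, rfl, hξ, fun j hj => ⟨?_, hv j hj⟩⟩
  induction j, hj using Nat.le_induction with
  | base => exact hn
  | succ j hj ih => rw [hξ, ih, hv j hj, mulVec_zero, mulVec_zero, add_zero]

/-! ### Solvability of the Riccati equation -/

namespace ControlLoop

variable {n m : ℕ} {c : ControlLoop n m}

/-- Steering to the origin in `n` periods and resting there costs nothing afterwards, so one finite
cost bounds every iterate. -/
theorem bddAbove_quadForm_valueIter (hQ : c.Q.PosDef) (hR : c.R.PosDef) {p : ℕ} (hp : 0 < p)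
    (hc : IsControllable (c.liftA p) (c.liftB p)) (x : Fin n → ℝ) :
    BddAbove (Set.range fun k => quadForm (c.valueIter p k) x) := by
  obtain ⟨ξ, v, rfl, hξ, h0⟩ := hc.exists_steering x
  refine ⟨∑ j ∈ Finset.range n, c.holdCost 0 p (ξ j) (v j), ?_⟩
  rintro _ ⟨k, rfl⟩
  refine (monotone_quadForm_valueIter hQ hR hp (ξ 0) (le_max_left k n)).trans ?_
  refine (quadForm_valueIter_le hQ hR hp (max k n) ξ v hξ).trans_eq ?_
  refine (Finset.sum_subset (by simp) fun j _ hj => ?_).symm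
  obtain ⟨h1, h2⟩ := h0 j (by simpa using hj)
  simp [h1, h2, holdCost, stageCost, liftState, quadForm_vec_zero]

/-- Monotone bounded quadratic forms converge, polarization turns this into convergence of the
matrices, and continuity of the operator makes the limit a fixed point. -/
theorem exists_isRiccatiSolution (hQ : c.Q.PosDef) (hR : c.R.PosDef) {p : ℕ} (hp : 0 < p)
    (hc : IsControllable (c.liftA p) (c.liftB p)) : ∃ P, c.IsRiccatiSolution p P := by
  have hsym : ∀ k, (c.valueIter p k)ᵀ = c.valueIter p k := fun k =>
    transpose_eq_of_posSemidef (posSemidef_valueIter hQ hR hp k)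
  have hx : ∀ x, ∃ L, Tendsto (fun k => quadForm (c.valueIter p k) x) atTop (𝓝 L) := fun x =>
    ⟨_, tendsto_atTop_ciSup (monotone_quadForm_valueIter hQ hR hp x)
      (bddAbove_quadForm_valueIter hQ hR hp hc x)⟩
  choose L hL using hx
  obtain ⟨P, hP⟩ : ∃ P, Tendsto (fun k => c.valueIter p k) atTop (𝓝 P) := by
    refine ⟨Matrix.of fun i j => (L (Pi.single i 1 + Pi.single j 1) - L (Pi.single i 1)
      - L (Pi.single j 1)) / 2, tendsto_pi_nhds.2 fun i => tendsto_pi_nhds.2 fun j => ?_⟩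
    simp only [apply_eq_quadForm (hsym _) i j, Matrix.of_apply]
    exact (((hL _).sub (hL _)).sub (hL _)).div_const 2
  have hPs : P.PosSemidef := by
    refine posSemidef_of_quadForm_nonneg ?_ fun x => ?_
    · have ht : Continuous fun M : Matrix (Fin n) (Fin n) ℝ => Mᵀ := by fun_prop
      have h1 := (ht.tendsto P).comp hP
      simp only [Function.comp_def, hsym] at h1
      exact tendsto_nhds_unique h1 hP
    · have ht : Continuous fun M : Matrix (Fin n) (Fin n) ℝ => quadForm M x := by
        unfold quadForm
        fun_prop
      exact ge_of_tendsto' ((ht.tendsto P).comp hP)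
        fun k => quadForm_nonneg (posSemidef_valueIter hQ hR hp k) x
  refine ⟨P, hPs, ?_⟩
  have h1 := (tendsto_riccatiStep hQ hR hp hPs).comp hP
  simp only [Function.comp_def, ← valueIter_succ] at h1
  exact tendsto_nhds_unique ((tendsto_add_atTop_iff_nat 1).2 hP) h1

theorem isRiccatiSolution_riccatiP (hQ : c.Q.PosDef) (hR : c.R.PosDef) {p : ℕ} (hp : 0 < p)
    (hc : IsControllable (c.liftA p) (c.liftB p)) : c.IsRiccatiSolution p (c.riccatiP p) :=
  Classical.epsilon_spec (exists_isRiccatiSolution hQ hR hp hc)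

end ControlLoop

/-! ### Conflict-free schedules modulo the period -/

section Schedule

variable {s : ℕ} {I0 : Finset ℕ} {p k : ℕ}

/-- After time `k`, all scheduled transmissions are in the future and pairwise incongruent modulo
the period. -/
def IsConflictFree (p k : ℕ) (next : Fin s → ℕ) : Prop :=
  (∀ q, k < next q) ∧ ∀ q q', q ≠ q' → ¬ (next q : ℤ) ≡ next q' [ZMOD p]

theorem mem_feasible_iff {others : Fin s → Prop} {next : Fin s → ℕ} {i : ℕ} :
    i ∈ feasible I0 p others next k ↔
      i ∈ I0 ∧ ∀ q, others q → ¬ ((k + i : ℕ) : ℤ) ≡ next q [ZMOD p] := by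
  refine and_congr_right fun _ => forall_congr' fun q => imp_congr_right fun _ => ?_
  rw [Int.modEq_iff_dvd, dvd_def, not_exists]
  refine ⟨fun h d hd => h (-d) ?_, fun h r hr => h (-r) ?_⟩ <;> push_cast at * <;> linarith

theorem IsConflictFree.of_initial {next : Fin s → ℕ} (hI0 : ∀ i ∈ I0, 0 < i)
    (h : ∀ ℓ, ∃ i ∈ feasible I0 p (fun q => q < ℓ) next 0, next ℓ = 0 + i) :
    IsConflictFree p 0 next := by
  have key : ∀ q q', q < q' → ¬ (next q' : ℤ) ≡ next q [ZMOD p] := fun q q' hq => by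
    obtain ⟨i, hi, hn⟩ := h q'
    rw [hn]
    exact (mem_feasible_iff.1 hi).2 q hq
  refine ⟨fun q => ?_, fun q q' hq => ?_⟩
  · obtain ⟨i, hi, hn⟩ := h q
    have := hI0 i hi.1
    omega
  · rcases lt_or_gt_of_ne hq with hlt | hlt
    · exact fun hm => key _ _ hlt hm.symm
    · exact key _ _ hlt

/-- Incongruent times are distinct, so at most one loop transmits at `k + 1`. Only its time changes,
and admissibility keeps it off the residues of the others. -/
theorem IsConflictFree.succ {next next' : Fin s → ℕ} (h : IsConflictFree p k next)
    (hI0 : ∀ i ∈ I0, 0 < i)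
    (hsample : ∀ ℓ, next ℓ = k + 1 →
      ∃ i ∈ feasible I0 p (fun q => q ≠ ℓ) next (k + 1), next' ℓ = k + 1 + i)
    (hhold : ∀ ℓ, next ℓ ≠ k + 1 → next' ℓ = next ℓ) : IsConflictFree p (k + 1) next' := by
  have key : ∀ q q', q ≠ q' → next q = k + 1 → ¬ (next' q : ℤ) ≡ next' q' [ZMOD p] := by
    intro q q' hq hk hm
    obtain ⟨i, hi, hn⟩ := hsample q hk
    have hk' : next q' ≠ k + 1 := fun hk' => h.2 q q' hq (by rw [hk, hk'])
    rw [hn, hhold q' hk'] at hm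
    exact (mem_feasible_iff.1 hi).2 q' hq.symm hm
  refine ⟨fun q => ?_, fun q q' hq => ?_⟩
  · by_cases hk : next q = k + 1
    · obtain ⟨i, hi, hn⟩ := hsample q hk
      have := hI0 i hi.1
      omega
    · have := h.1 q
      have := hhold q hk
      omega
  · by_cases hk : next q = k + 1
    · exact key q q' hq hk
    · by_cases hk' : next q' = k + 1
      · exact fun hm => key q' q hq.symm hk' hm.symm
      · rw [hhold q hk, hhold q' hk']
        exact h.2 q q' hq

/-- Waiting `p` preserves the residue of `k + 1 = next ℓ`, which no other loop occupies. -/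
theorem IsConflictFree.period_mem_feasible {next : Fin s → ℕ} (h : IsConflictFree p k next)
    (hp : p ∈ I0) {ℓ : Fin s} (hℓ : next ℓ = k + 1) :
    p ∈ feasible I0 p (fun q => q ≠ ℓ) next (k + 1) := by
  refine mem_feasible_iff.2 ⟨hp, fun q hq hm => h.2 ℓ q (Ne.symm hq) ?_⟩
  rw [hℓ]
  push_cast at hm ⊢
  exact Int.add_modEq_right.symm.trans hm

/-- At time `0` there is an admissible waiting time, whatever the loops before `ℓ` chose. -/
theorem feasible_initial_nonempty (hI : Finset.Icc 1 s ⊆ I0) (hsp : s ≤ p) (next : Fin s → ℕ)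
    (ℓ : Fin s) : (feasible I0 p (fun q => q < ℓ) next 0).Nonempty := by
  by_contra hne
  have hex : ∀ i : Fin s, ∃ q, q < ℓ ∧ ((i + 1 : ℕ) : ℤ) ≡ next q [ZMOD p] := by
    intro i
    by_contra hcon
    push Not at hcon
    refine hne ⟨i + 1, mem_feasible_iff.2 ⟨hI (Finset.mem_Icc.2 ⟨by omega, by omega⟩), ?_⟩⟩
    simpa using hcon
  -- Pigeonhole: the candidates `1, …, s` are incongruent since `s ≤ p`, so distinct candidates have
  -- distinct blockers. Then every loop is a blocker, including `ℓ`, although blockers precede `ℓ`.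
  choose f hf hmod using hex
  have hinj : Function.Injective f := by
    intro i j hij
    have h1 : ((i + 1 : ℕ) : ℤ) ≡ (j + 1 : ℕ) [ZMOD p] := by
      refine (hmod i).trans ?_
      rw [hij]
      exact (hmod j).symm
    have h2 := Nat.ModEq.add_right_cancel' 1 (Int.natCast_modEq_iff.1 h1)
    exact Fin.ext (h2.eq_of_lt_of_lt (by omega) (by omega))
  obtain ⟨i, hi⟩ := Finite.surjective_of_injective hinj ℓ
  exact (hf i).ne hi

end Schedule

theorem exists_controlStep {n m : ℕ} (c : ControlLoop n m) (p : ℕ) {I0 : Finset ℕ} {F : Set ℕ}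
    (hF : F ⊆ I0) (hne : F.Nonempty) (k : ℕ) (x : Fin n → ℝ) :
    ∃ v t, ControlStep c p F k x v t := by
  obtain ⟨i, hi, hmin⟩ :=
    Set.exists_min_image F (c.waitCost p x) (I0.finite_toSet.subset hF) hne
  exact ⟨_, _, i, hi, hmin, rfl, rfl⟩

theorem exists_seq_of_step {α : Type*} (P : ℕ → α → Prop) (R : ℕ → α → α → Prop) {a : α}
    (ha : P 0 a) (h : ∀ k a, P k a → ∃ b, R k a b ∧ P (k + 1) b) :
    ∃ f : ℕ → α, f 0 = a ∧ ∀ k, R k (f k) (f (k + 1)) := by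
  choose g hg hg' using h
  let f : ∀ k, {a // P k a} := fun k =>
    Nat.rec ⟨a, ha⟩ (fun k b => ⟨g k b.1 b.2, hg' k b.1 b.2⟩) k
  exact ⟨fun k => (f k).1, rfl, fun k => hg k _ _⟩

/-! ### Existence of executions -/

section Execution

variable {s : ℕ} {n m : Fin s → ℕ} {c : ∀ ℓ, ControlLoop (n ℓ) (m ℓ)} {I0 : Finset ℕ} {p : ℕ}

theorem exists_initial (c : ∀ ℓ, ControlLoop (n ℓ) (m ℓ)) (hI : Finset.Icc 1 s ⊆ I0)
    (hsp : s ≤ p) (x : ∀ ℓ, Fin (n ℓ) → ℝ) :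
    ∃ (u : ∀ ℓ, Fin (m ℓ) → ℝ) (next : Fin s → ℕ), ∀ ℓ,
      ControlStep (c ℓ) p (feasible I0 p (fun q => q < ℓ) next 0) 0 (x ℓ) (u ℓ) (next ℓ) := by
  -- Loops are scheduled one by one; an admissible set depends only on earlier loops, so later
  -- updates leave it unchanged.
  suffices H : ∀ b, ∃ next : Fin s → ℕ, ∀ ℓ : Fin s, (ℓ : ℕ) < b → ∃ v,
      ControlStep (c ℓ) p (feasible I0 p (fun q => q < ℓ) next 0) 0 (x ℓ) v (next ℓ) by
    obtain ⟨next, h⟩ := H s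
    choose u hu using fun ℓ : Fin s => h ℓ ℓ.2
    exact ⟨u, next, hu⟩
  intro b
  induction b with
  | zero => exact ⟨fun _ => 0, fun _ h => absurd h (Nat.not_lt_zero _)⟩
  | succ b ih =>
    obtain ⟨next, h⟩ := ih
    by_cases hb : b < s
    · obtain ⟨v, t, hv⟩ := exists_controlStep (c ⟨b, hb⟩) p
        (F := feasible I0 p (fun q => q < ⟨b, hb⟩) next 0) (fun _ hi => hi.1)
        (feasible_initial_nonempty hI hsp next _) 0 (x ⟨b, hb⟩)
      have hF : ∀ ℓ : Fin s, (ℓ : ℕ) ≤ b →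
          feasible I0 p (fun q => q < ℓ) (Function.update next ⟨b, hb⟩ t) 0 =
            feasible I0 p (fun q => q < ℓ) next 0 := by
        intro ℓ hℓ
        ext i
        simp only [mem_feasible_iff]
        refine and_congr_right fun _ => forall_congr' fun q => imp_congr_right fun hq => ?_
        have hqb : q ≠ ⟨b, hb⟩ := by
          rintro rfl
          exact absurd (Fin.lt_def.1 hq) (not_lt.2 hℓ)
        rw [Function.update_of_ne hqb]
      refine ⟨Function.update next ⟨b, hb⟩ t, fun ℓ hℓ => ?_⟩
      rw [hF ℓ (Nat.lt_succ_iff.1 hℓ)]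
      by_cases he : ℓ = ⟨b, hb⟩
      · subst he
        exact ⟨v, by simpa using hv⟩
      · have hlt : (ℓ : ℕ) < b :=
          lt_of_le_of_ne (Nat.lt_succ_iff.1 hℓ) fun h' => he (Fin.ext h')
        rw [Function.update_of_ne he]
        exact h ℓ hlt
    · exact ⟨next, fun ℓ _ => h ℓ (by omega)⟩

theorem ControlStep.exists_next {n m : ℕ} {c : ControlLoop n m} {p : ℕ} {F : Set ℕ} {k : ℕ}
    {x : Fin n → ℝ} {v : Fin m → ℝ} {t : ℕ} (h : ControlStep c p F k x v t) :
    ∃ i ∈ F, t = k + i := by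
  obtain ⟨i, hi, -, -, ht⟩ := h
  exact ⟨i, hi, ht⟩

theorem exists_isExecution (hI0 : ∀ i ∈ I0, 0 < i) (hp : p ∈ I0) (hI : Finset.Icc 1 s ⊆ I0)
    (hsp : s ≤ p) (x₀ : ∀ ℓ, Fin (n ℓ) → ℝ) :
    ∃ x u next, IsExecution c I0 p x u next ∧ ∀ ℓ, x ℓ 0 = x₀ ℓ := by
  obtain ⟨u₀, next₀, h0⟩ := exists_initial c hI hsp x₀
  let R : ℕ → ((∀ ℓ, Fin (n ℓ) → ℝ) × (∀ ℓ, Fin (m ℓ) → ℝ) × (Fin s → ℕ)) →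
      ((∀ ℓ, Fin (n ℓ) → ℝ) × (∀ ℓ, Fin (m ℓ) → ℝ) × (Fin s → ℕ)) → Prop := fun k a b =>
    (∀ ℓ, b.1 ℓ = (c ℓ).A *ᵥ a.1 ℓ + (c ℓ).B *ᵥ a.2.1 ℓ) ∧
    ∀ ℓ, (a.2.2 ℓ = k + 1 →
        ControlStep (c ℓ) p (feasible I0 p (fun q => q ≠ ℓ) a.2.2 (k + 1)) (k + 1)
          (b.1 ℓ) (b.2.1 ℓ) (b.2.2 ℓ)) ∧
      (a.2.2 ℓ ≠ k + 1 → b.2.1 ℓ = a.2.1 ℓ ∧ b.2.2 ℓ = a.2.2 ℓ)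
  obtain ⟨f, hf0, hf⟩ := exists_seq_of_step (fun k a => IsConflictFree p k a.2.2) R
    (a := (x₀, u₀, next₀)) (IsConflictFree.of_initial hI0 fun ℓ => (h0 ℓ).exists_next) (by
      rintro k ⟨x, u, next⟩ hcf
      have hstep : ∀ ℓ, ∃ v t,
          (next ℓ = k + 1 →
            ControlStep (c ℓ) p (feasible I0 p (fun q => q ≠ ℓ) next (k + 1)) (k + 1)
              ((c ℓ).A *ᵥ x ℓ + (c ℓ).B *ᵥ u ℓ) v t) ∧
          (next ℓ ≠ k + 1 → v = u ℓ ∧ t = next ℓ) := by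
        intro ℓ
        by_cases hk : next ℓ = k + 1
        · obtain ⟨v, t, hv⟩ := exists_controlStep (c ℓ) p
            (F := feasible I0 p (fun q => q ≠ ℓ) next (k + 1)) (fun _ hi => hi.1)
            ⟨p, hcf.period_mem_feasible hp hk⟩ (k + 1) ((c ℓ).A *ᵥ x ℓ + (c ℓ).B *ᵥ u ℓ)
          exact ⟨v, t, fun _ => hv, fun h => absurd hk h⟩
        · exact ⟨u ℓ, next ℓ, fun h => absurd h hk, fun _ => ⟨rfl, rfl⟩⟩
      choose v t hv using hstep
      exact ⟨(fun ℓ => (c ℓ).A *ᵥ x ℓ + (c ℓ).B *ᵥ u ℓ, v, t), ⟨fun _ => rfl, hv⟩,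
        hcf.succ hI0 (fun ℓ hk => ((hv ℓ).1 hk).exists_next) fun ℓ hk => ((hv ℓ).2 hk).2⟩)
  refine ⟨fun ℓ k => (f k).1 ℓ, fun ℓ k => (f k).2.1 ℓ, fun ℓ k => (f k).2.2 ℓ, ?_, ?_⟩
  · refine ⟨fun ℓ k => (hf k).1 ℓ, ?_, fun ℓ k => ((hf k).2 ℓ).1, fun ℓ k => ((hf k).2 ℓ).2⟩
    simpa only [hf0] using h0
  · simp only [hf0, implies_true]

/-! ### Lyapunov decrease and convergence -/

namespace IsExecution

variable {x : ∀ ℓ, ℕ → Fin (n ℓ) → ℝ} {u : ∀ ℓ, ℕ → Fin (m ℓ) → ℝ} {next : Fin s → ℕ → ℕ}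

theorem isConflictFree (h : IsExecution c I0 p x u next) (hI0 : ∀ i ∈ I0, 0 < i) (k : ℕ) :
    IsConflictFree p k fun q => next q k := by
  induction k with
  | zero => exact IsConflictFree.of_initial hI0 fun ℓ => (h.init ℓ).exists_next
  | succ k ih =>
    exact ih.succ hI0 (fun ℓ hk => (h.sample ℓ k hk).exists_next) fun ℓ hk => (h.hold ℓ k hk).2

theorem hold_of_lt (h : IsExecution c I0 p x u next) (ℓ : Fin s) (k q : ℕ)
    (hq : k + q < next ℓ k) : u ℓ (k + q) = u ℓ k ∧ next ℓ (k + q) = next ℓ k := by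
  induction q with
  | zero => exact ⟨rfl, rfl⟩
  | succ q ih =>
    obtain ⟨h1, h2⟩ := ih (by omega)
    obtain ⟨h3, h4⟩ := h.hold ℓ (k + q) (by omega)
    exact ⟨h3.trans h1, h4.trans h2⟩

theorem state_eq_liftState (h : IsExecution c I0 p x u next) (ℓ : Fin s) (k q : ℕ)
    (hq : k + q ≤ next ℓ k) : x ℓ (k + q) = (c ℓ).liftState q (x ℓ k) (u ℓ k) := by
  induction q with
  | zero => rw [ControlLoop.liftState_zero, add_zero]
  | succ q ih =>
    rw [ControlLoop.liftState_succ, ← ih (by omega), ← add_assoc, h.dynamics,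
      (h.hold_of_lt ℓ k q (by omega)).1]

/-- The cost accumulated from time `k` until the next transmission of sensor `ℓ`, plus the
terminal cost there. -/
def remainingCost (c : ∀ ℓ, ControlLoop (n ℓ) (m ℓ)) (p : ℕ) (x : ∀ ℓ, ℕ → Fin (n ℓ) → ℝ)
    (u : ∀ ℓ, ℕ → Fin (m ℓ) → ℝ) (next : Fin s → ℕ → ℕ) (ℓ : Fin s) (k : ℕ) : ℝ :=
  ∑ q ∈ Finset.Ico k (next ℓ k), (c ℓ).stageCost (x ℓ q) (u ℓ q)
    + quadForm ((c ℓ).riccatiP p) (x ℓ (next ℓ k))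

theorem remainingCost_eq_holdCost (h : IsExecution c I0 p x u next) (ℓ : Fin s) (k i : ℕ)
    (hi : next ℓ k = k + i) :
    remainingCost c p x u next ℓ k =
      (c ℓ).holdCost ((c ℓ).riccatiP p) i (x ℓ k) (u ℓ k) := by
  rw [remainingCost, ControlLoop.holdCost, hi, h.state_eq_liftState ℓ k i hi.ge,
    Finset.sum_Ico_eq_sum_range, Nat.add_sub_cancel_left]
  congr 1
  refine Finset.sum_congr rfl fun q hq => ?_
  have hlt : k + q < next ℓ k := by
    have := Finset.mem_range.1 hq
    omega
  rw [h.state_eq_liftState ℓ k q hlt.le, (h.hold_of_lt ℓ k q hlt).1]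

/-- The sampling cost `α / i` is not part of the Lyapunov function; it enters only through `hα`,
which lets it be dropped from the comparison with `p`. -/
theorem remainingCost_succ_le (h : IsExecution c I0 p x u next) (hI0 : ∀ i ∈ I0, 0 < i)
    (hp : p ∈ I0) {ℓ : Fin s} (hQ : (c ℓ).Q.PosDef) (hR : (c ℓ).R.PosDef)
    (hP : (c ℓ).IsRiccatiSolution p ((c ℓ).riccatiP p))
    (hα : ∀ i ∈ I0, (c ℓ).α / p ≤ (c ℓ).α / i) (k : ℕ) :
    (c ℓ).stageCost (x ℓ k) (u ℓ k) + remainingCost c p x u next ℓ (k + 1) ≤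
      remainingCost c p x u next ℓ k := by
  have hcf := h.isConflictFree hI0 k
  conv_rhs => rw [remainingCost, Finset.sum_eq_sum_Ico_succ_bot (show k < next ℓ k from hcf.1 ℓ), add_assoc]
  refine add_le_add_right ?_ _
  by_cases hk : next ℓ k = k + 1
  · obtain ⟨i, hi, hmin, hv, ht⟩ := h.sample ℓ k hk
    rw [h.remainingCost_eq_holdCost ℓ (k + 1) i ht, hv, ControlLoop.gainL,
      ControlLoop.holdCost_riccatiGain hQ hR (hI0 i hi.1) hP.1, hk]
    -- The Riccati equation identifies the cost of the candidate `p` with the terminal cost already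
    -- counted at this sample.
    have h1 := hmin p (hcf.period_mem_feasible hp hk)
    have h2 := hα i hi.1
    rw [ControlLoop.waitCost, ControlLoop.waitCost, ControlLoop.costP, ControlLoop.costP,
      ← hP.2] at h1
    simp only [Finset.Ico_self, Finset.sum_empty]
    linarith
  · rw [remainingCost, (h.hold ℓ k hk).2]

theorem tendsto_zero (h : IsExecution c I0 p x u next) (hI0 : ∀ i ∈ I0, 0 < i)
    (hp : p ∈ I0) {ℓ : Fin s} (hQ : (c ℓ).Q.PosDef) (hR : (c ℓ).R.PosDef)
    (hP : (c ℓ).IsRiccatiSolution p ((c ℓ).riccatiP p))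
    (hα : ∀ i ∈ I0, (c ℓ).α / p ≤ (c ℓ).α / i) :
    Tendsto (fun k => x ℓ k) atTop (𝓝 0) := by
  have hnn : ∀ k, 0 ≤ (c ℓ).stageCost (x ℓ k) (u ℓ k) := fun k =>
    ControlLoop.stageCost_nonneg hQ hR _ _
  have hW : ∀ k, 0 ≤ remainingCost c p x u next ℓ k := fun k =>
    add_nonneg (Finset.sum_nonneg fun q _ => hnn q) (quadForm_nonneg hP.1 _)
  have hsum : ∀ k, ∑ q ∈ Finset.range k, (c ℓ).stageCost (x ℓ q) (u ℓ q)
      + remainingCost c p x u next ℓ k ≤ remainingCost c p x u next ℓ 0 := by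
    intro k
    induction k with
    | zero => simp
    | succ k ih =>
      rw [Finset.sum_range_succ]
      linarith [h.remainingCost_succ_le hI0 hp hQ hR hP hα k]
  have hsummable := summable_of_sum_range_le hnn fun k =>
    (le_add_of_nonneg_right (hW k)).trans (hsum k)
  refine tendsto_zero_of_quadForm hQ (squeeze_zero (fun k => quadForm_nonneg hQ.posSemidef _)
    (fun k => ?_) hsummable.tendsto_atTop_zero)
  exact le_add_of_nonneg_right (quadForm_nonneg hR.posSemidef _)

end IsExecution

end Execution

/-- A `γ`-th root of unity is `exp (2πij/γ)`, and `j ≠ 0` unless it equals `1`; such arguments are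
exactly the excluded ones. -/
theorem EigenvalueArgumentCondition.pow_ne_one {n : ℕ} {A : Matrix (Fin n) (Fin n) ℝ} {γ : ℕ}
    (h : EigenvalueArgumentCondition A γ) (hγ : γ ≠ 0) {z : ℂ} (hz : z ∈ eigenvalues A)
    (hz1 : z ≠ 1) : z ^ γ ≠ 1 := by
  intro hpow
  have : NeZero γ := ⟨hγ⟩
  obtain ⟨j, -, hj⟩ := (Complex.isPrimitiveRoot_exp γ hγ).eq_pow_of_pow_eq_one hpow
  have hj0 : j ≠ 0 := by
    rintro rfl
    exact hz1 (by simpa using hj.symm)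
  refine h ⟨z, hz, hz1, Complex.norm_eq_one_of_pow_eq_one hpow hγ, j, Nat.pos_of_ne_zero hj0, ?_⟩
  have he : z = Complex.exp ((2 * Real.pi / γ * j : ℝ) * Complex.I) := by
    rw [← hj, ← Complex.exp_nat_mul]
    congr 1
    push_cast
    ring
  rw [he, Complex.arg_exp_mul_I, Real.Angle.coe_toIocMod]

end SelfTriggeredMPC

end

theorem corollary2 {s : ℕ} {n m : Fin s → ℕ} (c : ∀ ℓ, ControlLoop (n ℓ) (m ℓ))
    (I0 : Finset ℕ) (γ p : ℕ)
    (hI0 : ∀ i ∈ I0, 0 < i)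
    (hQ : ∀ ℓ, (c ℓ).Q.PosDef) (hR : ∀ ℓ, (c ℓ).R.PosDef) (hα : ∀ ℓ, 0 ≤ (c ℓ).α)
    (hctrl : ∀ ℓ, IsControllable (c ℓ).A (c ℓ).B)
    (hγ : IsGreatest (I0 : Set ℕ) γ)
    (hp : IsGreatest {i | i ∈ I0 ∧ ∀ ℓ, ∀ z ∈ eigenvalues (c ℓ).A, z ≠ 1 → z ^ i ≠ 1} p)
    (hctrl_p : ∀ ℓ, IsControllable ((c ℓ).liftA p) ((c ℓ).liftB p))
    (hL : Finset.Icc 1 s ⊆ I0) (hsp : s ≤ p)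
    (hcase : (∀ ℓ, EigenvalueArgumentCondition (c ℓ).A γ) ∨ (∀ ℓ, (c ℓ).α = 0)) :
    (∀ x₀ : ∀ ℓ, Fin (n ℓ) → ℝ, ∃ x u next,
      IsExecution c I0 p x u next ∧ ∀ ℓ, x ℓ 0 = x₀ ℓ) ∧
    ∀ x u next, IsExecution c I0 p x u next →
      ∀ ℓ, Tendsto (fun k => x ℓ k) atTop (𝓝 0) := by
  have hpI : p ∈ I0 := hp.1.1
  have hp0 : 0 < p := hI0 p hpI
  have hγI : γ ∈ I0 := hγ.1
  -- In case (a) `γ` itself qualifies in the maximum defining `p`, so `p` bounds all of `I0`.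
  have hαp : ∀ ℓ, ∀ i ∈ I0, (c ℓ).α / p ≤ (c ℓ).α / i := by
    intro ℓ i hi
    rcases hcase with ha | hb
    · have hγp : γ ≤ p :=
        hp.2 ⟨hγI, fun ℓ z hz hz1 => (ha ℓ).pow_ne_one (hI0 γ hγI).ne' hz hz1⟩
      have hip : i ≤ p := (hγ.2 hi).trans hγp
      have hi0 : (0 : ℝ) < i := by exact_mod_cast hI0 i hi
      exact div_le_div_of_nonneg_left (hα ℓ) hi0 (by exact_mod_cast hip)
    · simp [hb ℓ]
  exact ⟨exists_isExecution hI0 hpI hL hsp, fun x u next h ℓ =>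
    h.tendsto_zero hI0 hpI (hQ ℓ) (hR ℓ)
      (ControlLoop.isRiccatiSolution_riccatiP (hQ ℓ) (hR ℓ) hp0 (hctrl_p ℓ)) (hαp ℓ)⟩
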